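/- Let $\mathcal X$ be a measurable input space (for instance $\mathcal X\subset\mathbb R^N$), $\mathcal Y\subset\mathbb R$ an output set with $|y|\le B$ for all $y\in\mathcal Y$, and $\mathcal D$ a probability distribution on $\mathcal X\times\mathcal Y$. Let $m\ge 1$, let $\delta\in(0,1)$ and let $S=((x_1,y_1),\dots,(x_m,y_m))\sim\mathcal D^m$. Let $\mathcal F$ be a class of functions $\mathcal X\to\mathbb R$ that is bounded at every point and contains the zero function, with Rademacher complexity $$\mathcal R_m(\mathcal F)=\mathbb E_{S\sim\mathcal D^m}\,\mathbb E_\sigma\Big[\sup_{f\in\mathcal F}\frac1m\sum_{i=1}^m\sigma_i f(x_i)\Big],\qquad \sigma_1,\dots,\sigma_m \text{ i.i.d. uniform in }\{-1,1\}$$ (assumed well defined, i.e. the inner expectation is an integrable function of $S$). A feature map is a tuple $\Phi=(\phi_1,\dots,\phi_D)$ of functions $\phi_i\in\mathcal F$ with $\phi_i\ge 0$ and $\|\Phi(x)\|_2\le A$ for all $x\in\mathcal X$. It is called $\vartheta$-diverse if $\frac12\sum_{i\ne j}(\phi_i(x)-\phi_j(x))^2\ge\vartheta^2$ for every $x\in\mathcal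 X$, the sum being over ordered pairs. Let $\mathcal G$ be a nonempty, possibly random, (measurable) set of feature maps, independent of $S$, and let $\tau$ be such that, with probability at least $\tau$, all $\Phi\in\mathcal G$ are $\vartheta$-diverse. For a bound $\|w\|_\infty$ on the weights put $$\mathcal H=\Big\{h(x)=v^T\Phi(x)=\sum_{i=1}^D v_i\phi_i(x)\ :\ \Phi\in\mathcal G,\ v\in\mathbb R^D,\ \max_i|v_i|\le\|w\|_\infty\Big\},$$ and let $E(h,x,y)=|h(x)-y|$. Then, with probability at least $(1-\delta)\tau$ over $\mathcal G$ and $S$ jointly, the following holds for all $h\in\mathcal H$: $$\mathbb E_{(x,y)\sim\mathcal D}[E(h,x,y)]-\frac1m\sum_{i=1}^m E(h,x_i,y_i)\ \le\ 4D\|w\|_\infty\,\mathcal R_m(\mathcal F)+\big(\|w\|_\infty\sqrt{DA^2-\vartheta^2}+B\big)\sqrt{\frac{\log(2/\delta)}{2m}} .$$ -/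

import Mathlib

open MeasureTheory Filter Topology

noncomputable section

/-- The event `Q` holds with probability at least `p`: it contains a measurable event of
probability at least `p` (for a measurable event this is `p ≤ P {ω | Q ω}`). -/
def HoldsWithProbAtLeast {Ω : Type*} [MeasurableSpace Ω] (P : Measure Ω) (p : ℝ)
    (Q : Ω → Prop) : Prop :=
  ∃ E : Set Ω, MeasurableSet E ∧ (∀ ω ∈ E, Q ω) ∧ ENNReal.ofReal p ≤ P E

/-- Empirical Rademacher complexity of a class `F` of real functions on the points
`x 0, …, x (m - 1)`: the average over all sign vectors `σ ∈ {-1, 1}^m` of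
`sup_{f ∈ F} (1/m) ∑ i, σ i * f (x i)`. -/
def empiricalRademacher {X : Type*} {m : ℕ} (F : Set (X → ℝ)) (x : Fin m → X) : ℝ :=
  (1 / 2 ^ m : ℝ) * ∑ σ : Fin m → ℤˣ,
    ⨆ f : F, (1 / m : ℝ) * ∑ i, ((σ i : ℤ) : ℝ) * (f : X → ℝ) (x i)

/-- Rademacher complexity: the expectation of the empirical Rademacher complexity over
a sample of `m` independent labelled points with law `μ`. -/
def rademacher {X : Type*} [MeasurableSpace X] (μ : Measure (X × ℝ)) (m : ℕ)
    (F : Set (X → ℝ)) : ℝ :=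
  ∫ S : Fin m → X × ℝ, empiricalRademacher F (fun i => (S i).1) ∂(Measure.pi fun _ => μ)

/-- The feature functions `Φ 0, …, Φ (D - 1)` are `ϑ`-diverse: at every input, half the sum
over all ordered pairs `i ≠ j` of the squared differences is at least `ϑ ^ 2`. -/
def IsDiverse {X : Type*} {D : ℕ} (ϑ : ℝ) (Φ : Fin D → X → ℝ) : Prop :=
  ∀ x, ϑ ^ 2 ≤ (1 / 2 : ℝ) *
    ∑ p ∈ (Finset.univ : Finset (Fin D)).offDiag, (Φ p.1 x - Φ p.2 x) ^ 2

/-- Feature maps built from the class `F`: the components are nonnegative members of `F` and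
the Euclidean norm of the feature vector is at most `A` at every input. -/
structure IsFeatureMap {X : Type*} {D : ℕ} (F : Set (X → ℝ)) (A : ℝ)
    (Φ : Fin D → X → ℝ) : Prop where
  mem : ∀ i, Φ i ∈ F
  nonneg : ∀ i x, 0 ≤ Φ i x
  norm_le : ∀ x, ‖WithLp.toLp 2 (fun i => Φ i x)‖ ≤ A

/-- Measurability of a random class `𝒢 ω` of feature maps: some jointly measurable sequence of
selections `g n ω ∈ 𝒢 ω` is, for every `ω`, sequentially dense in `𝒢 ω` for pointwise
convergence. (For a one-element class `{Φ ω}` this is joint measurability of `Φ`.) -/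
def IsMeasurableFeatureClass {Ω X : Type*} [MeasurableSpace Ω] [MeasurableSpace X] {D : ℕ}
    (𝒢 : Ω → Set (Fin D → X → ℝ)) : Prop :=
  ∃ g : ℕ → Ω → Fin D → X → ℝ,
    (∀ n i, Measurable fun p : Ω × X => g n p.1 i p.2) ∧
    ∀ ω, (∀ n, g n ω ∈ 𝒢 ω) ∧
      ∀ Φ ∈ 𝒢 ω, ∃ k : ℕ → ℕ,
        ∀ i x, Tendsto (fun n => g (k n) ω i x) atTop (𝓝 (Φ i x))

/-- The hypothesis class of all `x ↦ ∑ i, w i * Φ i x` with `Φ ∈ G` and `‖w‖∞ ≤ W`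
(the norm on `Fin D → ℝ` is the sup norm). -/
def hypothesisClass {X : Type*} {D : ℕ} (W : ℝ) (G : Set (Fin D → X → ℝ)) : Set (X → ℝ) :=
  {h | ∃ Φ ∈ G, ∃ w : Fin D → ℝ, ‖w‖ ≤ W ∧ h = fun x => ∑ i, w i * Φ i x}

/-- The energy `E(h, x, y) = |h x - y|`. -/
def energyL1 {X : Type*} (h : X → ℝ) (x : X) (y : ℝ) : ℝ := |h x - y|

/-- Generalization gap: expected energy minus the average energy on the sample `S`. -/
def generalizationGap {X : Type*} [MeasurableSpace X] {m : ℕ}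
    (E : (X → ℝ) → X → ℝ → ℝ) (μ : Measure (X × ℝ)) (S : Fin m → X × ℝ) (h : X → ℝ) : ℝ :=
  (∫ z, E h z.1 z.2 ∂μ) - (1 / m : ℝ) * ∑ i, E h (S i).1 (S i).2

end

/-! Fix a realisation of the feature class in the diverse event. Half the sum of squared differences
of the features equals `D * ∑ φ_i² - (∑ φ_i)²`, so diversity and the norm bound give `∑ φ_i ≤ √(D A²
- ϑ²)` (`IsFeatureMap.sum_le`). As features are nonnegative, hypotheses are bounded by `W` times
this root, and the absolute loss takes values in an interval of length `M = W √(D A² - ϑ²) + B`.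
This is the only role of diversity.

For a countable class of such losses, the largest deviation changes by at most `M / m` when one
sample point changes, so McDiarmid's inequality concentrates it around its mean. Symmetrization
bounds the mean by twice a Rademacher average of the losses; contraction removes the absolute value
and the label; linearity in the features leaves `2 D W` times the complexity of `F`. Hence the
constant 4 (`uniform_deviation`, `signAverage_contraction`, `signAverage_linear_le`).

Countability keeps suprema measurable. The full class is recovered by pointwise limits of a dense
sequence of selections and weights, the gap being continuous along them. Since the sample is
independent of the features, Fubini over the diverse event yields the product `(1 - δ) τ`. -/

/-! ### Bounded differences inequality. -/

theorem integrable_of_measurable_of_abs_le {α : Type*} [MeasurableSpace α] {ν : Measure α}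
    [IsFiniteMeasure ν] {f : α → ℝ} (hf : Measurable f) {K : ℝ} (hK : ∀ x, |f x| ≤ K) :
    Integrable f ν :=
  Integrable.of_bound hf.aestronglyMeasurable K (ae_of_all _ hK)

theorem integral_pi_fin_succ {Z : Type*} [MeasurableSpace Z] (μ : Measure Z)
    [IsProbabilityMeasure μ] {m : ℕ} {f : (Fin (m + 1) → Z) → ℝ}
    (hf : Integrable f (Measure.pi fun _ => μ)) :
    ∫ S, f S ∂(Measure.pi fun _ : Fin (m + 1) => μ) =
      ∫ T, ∫ z, f (Fin.cons z T) ∂μ ∂(Measure.pi fun _ : Fin m => μ) := by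
  have hp := (measurePreserving_piFinSuccAbove (fun _ : Fin (m + 1) => μ) 0).symm
  have hi := (hp.integrable_comp_emb (MeasurableEquiv.measurableEmbedding _)).2 hf
  rw [← hp.integral_comp']
  refine (integral_prod_symm _ hi).trans ?_
  simp [MeasurableEquiv.piFinSuccAbove_symm_apply, Fin.insertNthEquiv]

theorem measurable_fin_cons {Z : Type*} [MeasurableSpace Z] {m : ℕ} :
    Measurable fun p : Z × (Fin m → Z) => (Fin.cons p.1 p.2 : Fin (m + 1) → Z) := by
  refine measurable_pi_lambda _ fun i => ?_
  refine Fin.cases ?_ (fun j => ?_) i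
  · simpa using measurable_fst
  · simpa [Function.comp_def] using (measurable_pi_apply j).comp measurable_snd

/-- Hoeffding's lemma: oscillation at most `c` confines `f` to an interval of length `c` starting at
its infimum. -/
theorem integral_exp_le_of_oscillation_le {Z : Type*} [MeasurableSpace Z] (μ : Measure Z)
    [IsProbabilityMeasure μ] {f : Z → ℝ} (hf : Measurable f) {c : ℝ}
    (hc : ∀ z z', |f z - f z'| ≤ c) (t : ℝ) :
    ∫ z, Real.exp (t * f z) ∂μ ≤ Real.exp (t * ∫ z, f z ∂μ + t ^ 2 * c ^ 2 / 8) := by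
  have : Nonempty Z := μ.nonempty_of_neZero
  obtain ⟨z₀⟩ := this
  have hbdd : BddBelow (Set.range f) := by
    refine ⟨f z₀ - c, ?_⟩
    rintro _ ⟨z, rfl⟩
    linarith [(abs_le.1 (hc z z₀)).1]
  have hne : Nonempty Z := ⟨z₀⟩
  have hmem : ∀ z, f z ∈ Set.Icc (⨅ z, f z) ((⨅ z, f z) + c) := by
    refine fun z => ⟨ciInf_le hbdd z, ?_⟩
    have : f z - c ≤ ⨅ z, f z := le_ciInf fun z' => by linarith [(abs_le.1 (hc z z')).2]
    linarith
  have h := (ProbabilityTheory.hasSubgaussianMGF_of_mem_Icc (μ := μ) hf.aemeasurable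
    (ae_of_all _ hmem)).mgf_le t
  have h2 : ProbabilityTheory.mgf (fun z => f z - ∫ z, f z ∂μ) μ t
      = Real.exp (-(t * ∫ z, f z ∂μ)) * ∫ z, Real.exp (t * f z) ∂μ := by
    rw [ProbabilityTheory.mgf, ← integral_const_mul]
    congr 1
    ext z
    rw [← Real.exp_add]
    ring_nf
  rw [h2] at h
  have h3 := mul_le_mul_of_nonneg_left h (Real.exp_nonneg (t * ∫ z, f z ∂μ))
  rw [← mul_assoc, ← Real.exp_add, ← Real.exp_add, add_neg_cancel, Real.exp_zero, one_mul] at h3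
  refine h3.trans (Real.exp_le_exp.2 (le_of_eq ?_))
  simp only [NNReal.coe_pow, NNReal.coe_div, coe_nnnorm, add_sub_cancel_left, Real.norm_eq_abs,
    NNReal.coe_ofNat, div_pow, sq_abs]
  ring

/-- Integrating out the first coordinate preserves bounded differences, and Hoeffding's lemma for
that coordinate, with the others frozen, costs one factor `exp (t² c² / 8)`; induction collects `m`
of them. -/
theorem integral_exp_le_of_bounded_differences {Z : Type*} [MeasurableSpace Z] (μ : Measure Z)
    [IsProbabilityMeasure μ] (c t : ℝ) (m : ℕ) (f : (Fin m → Z) → ℝ) (hf : Measurable f)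
    (K : ℝ) (hK : ∀ S, |f S| ≤ K)
    (hc : ∀ S i z, |f (Function.update S i z) - f S| ≤ c) :
    ∫ S, Real.exp (t * f S) ∂(Measure.pi fun _ => μ) ≤
      Real.exp (t * ∫ S, f S ∂(Measure.pi fun _ => μ) + m * (t ^ 2 * c ^ 2 / 8)) := by
  have hexp : ∀ {α : Type _} (g : α → ℝ), (∀ x, |g x| ≤ K) →
      ∀ x, |Real.exp (t * g x)| ≤ Real.exp (|t| * K) := by
    intro α g hg x
    rw [abs_of_pos (Real.exp_pos _), Real.exp_le_exp]
    calc t * g x ≤ |t * g x| := le_abs_self _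
      _ = |t| * |g x| := abs_mul _ _
      _ ≤ |t| * K := by gcongr; exact hg x
  induction m with
  | zero =>
    have : f = fun _ => f finZeroElim := funext fun S => congrArg f (Subsingleton.elim _ _)
    rw [this]
    simp
  | succ m ih =>
    set g : (Fin m → Z) → ℝ := fun T => ∫ z, f (Fin.cons z T) ∂μ with hg
    have hfc : Measurable fun p : Z × (Fin m → Z) => f (Fin.cons p.1 p.2) :=
      hf.comp measurable_fin_cons
    have hfT : ∀ T : Fin m → Z, Measurable fun z => f (Fin.cons z T) := fun T =>
      hfc.comp (measurable_id.prodMk measurable_const)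
    have hfTi : ∀ T : Fin m → Z, Integrable (fun z => f (Fin.cons z T)) μ := fun T =>
      integrable_of_measurable_of_abs_le (hfT T) fun z => hK _
    have hgm : Measurable g := (hfc.stronglyMeasurable.integral_prod_left).measurable
    have hgK : ∀ T, |g T| ≤ K := by
      intro T
      have := norm_integral_le_of_norm_le_const (μ := μ) (f := fun z => f (Fin.cons z T))
        (C := K) (ae_of_all _ fun z => hK _)
      simpa using this
    have hgc : ∀ T i z, |g (Function.update T i z) - g T| ≤ c := by
      intro T i z
      have h1 : g (Function.update T i z) - g T
          = ∫ y, (f (Fin.cons y (Function.update T i z)) - f (Fin.cons y T)) ∂μ :=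
        (integral_sub (hfTi _) (hfTi _)).symm
      rw [h1]
      have := norm_integral_le_of_norm_le_const (μ := μ)
        (f := fun y => f (Fin.cons y (Function.update T i z)) - f (Fin.cons y T))
        (C := c) (ae_of_all _ fun y => by
          rw [Fin.cons_update]; exact hc _ _ _)
      simpa using this
    have hstep : ∀ T : Fin m → Z, ∫ z, Real.exp (t * f (Fin.cons z T)) ∂μ ≤
        Real.exp (t * g T) * Real.exp (t ^ 2 * c ^ 2 / 8) := by
      intro T
      rw [← Real.exp_add]
      refine integral_exp_le_of_oscillation_le μ (hfT T) (fun z z' => ?_) t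
      have := hc (Fin.cons z' T) 0 z
      rwa [Fin.update_cons_zero] at this
    have hem : Measurable fun S => Real.exp (t * f S) := (hf.const_mul t).exp
    rw [integral_pi_fin_succ μ (integrable_of_measurable_of_abs_le hem (hexp f hK)),
      integral_pi_fin_succ μ (integrable_of_measurable_of_abs_le hf hK)]
    have hgem : Measurable fun T => Real.exp (t * g T) := (hgm.const_mul t).exp
    calc ∫ T, ∫ z, Real.exp (t * f (Fin.cons z T)) ∂μ ∂(Measure.pi fun _ : Fin m => μ)
        ≤ ∫ T, Real.exp (t * g T) * Real.exp (t ^ 2 * c ^ 2 / 8)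
            ∂(Measure.pi fun _ : Fin m => μ) := by
          refine integral_mono_of_nonneg
            (ae_of_all _ fun T => integral_nonneg fun z => (Real.exp_pos _).le)
            ((integrable_of_measurable_of_abs_le hgem (hexp g hgK)).mul_const _)
            (ae_of_all _ hstep)
      _ = (∫ T, Real.exp (t * g T) ∂(Measure.pi fun _ : Fin m => μ)) *
            Real.exp (t ^ 2 * c ^ 2 / 8) := integral_mul_const _ _
      _ ≤ Real.exp (t * ∫ T, g T ∂(Measure.pi fun _ : Fin m => μ) + m * (t ^ 2 * c ^ 2 / 8)) *
            Real.exp (t ^ 2 * c ^ 2 / 8) := by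
          gcongr
          exact ih g hgm hgK hgc
      _ = _ := by
          rw [← Real.exp_add]
          push_cast
          simp only [hg]
          ring_nf

/-- McDiarmid's bounded differences inequality, upper tail. -/
theorem measureReal_le_exp_of_bounded_differences {Z : Type*} [MeasurableSpace Z] (μ : Measure Z)
    [IsProbabilityMeasure μ] {c : ℝ} (hc0 : 0 < c) {m : ℕ} (hm : 0 < m)
    {f : (Fin m → Z) → ℝ} (hf : Measurable f)
    {K : ℝ} (hK : ∀ S, |f S| ≤ K)
    (hc : ∀ S i z, |f (Function.update S i z) - f S| ≤ c) {ε : ℝ} (hε : 0 ≤ ε) :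
    (Measure.pi fun _ : Fin m => μ).real
        {S | (∫ S, f S ∂(Measure.pi fun _ => μ)) + ε ≤ f S} ≤
      Real.exp (-(2 * ε ^ 2 / (m * c ^ 2))) := by
  have hm' : (0 : ℝ) < m := by exact_mod_cast hm
  -- The minimiser of the Chernoff exponent `-t ε + m t² c² / 8`.
  set t : ℝ := 4 * ε / (m * c ^ 2) with ht
  have ht0 : 0 ≤ t := by positivity
  have hexp : ∀ S, |Real.exp (t * f S)| ≤ Real.exp (t * K) := by
    intro S
    rw [abs_of_pos (Real.exp_pos _), Real.exp_le_exp]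
    gcongr
    exact (abs_le.1 (hK S)).2
  have h1 := ProbabilityTheory.measure_ge_le_exp_mul_mgf
    (μ := Measure.pi fun _ : Fin m => μ) (X := f)
    ((∫ S, f S ∂(Measure.pi fun _ => μ)) + ε) ht0
    (integrable_of_measurable_of_abs_le (hf.const_mul t).exp hexp)
  refine h1.trans ?_
  refine (mul_le_mul_of_nonneg_left
    (integral_exp_le_of_bounded_differences μ c t m f hf K hK hc) (Real.exp_nonneg _)).trans ?_
  rw [← Real.exp_add, Real.exp_le_exp]
  apply le_of_eq
  have hc' := hc0.ne'
  have hm'' := hm'.ne'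
  rw [ht]
  field_simp
  ring

/-! ### Contraction and linear classes for Rademacher averages. -/

theorem bddAbove_range_of_abs_le {ι : Type*} {f : ι → ℝ} {K : ℝ} (h : ∀ i, |f i| ≤ K) :
    BddAbove (Set.range f) :=
  ⟨K, by rintro _ ⟨i, rfl⟩; exact (abs_le.1 (h i)).2⟩

/-- Choose indices `k`, `l` for the two suprema on the left: `b k - b l` is at most `a k - a l` or
`a l - a k`, and in the second case `k` and `l` trade places on the right. -/
theorem ciSup_add_contraction {ι : Type*} [Nonempty ι] {u a b : ι → ℝ} {U A : ℝ}
    (hu : ∀ k, |u k| ≤ U) (ha : ∀ k, |a k| ≤ A) (hab : ∀ k l, |b k - b l| ≤ |a k - a l|) :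
    (⨆ k, (u k + b k)) + ⨆ k, (u k - b k) ≤ (⨆ k, (u k + a k)) + ⨆ k, (u k - a k) := by
  have h1 : BddAbove (Set.range fun k => u k + a k) :=
    bddAbove_range_of_abs_le (K := U + A) fun k =>
      (abs_add_le _ _).trans (add_le_add (hu k) (ha k))
  have h2 : BddAbove (Set.range fun k => u k - a k) :=
    bddAbove_range_of_abs_le (K := U + A) fun k => (abs_sub _ _).trans (add_le_add (hu k) (ha k))
  refine ciSup_add_ciSup_le fun k l => ?_
  have hk1 := le_ciSup h1 k
  have hk2 := le_ciSup h2 k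
  have hl1 := le_ciSup h1 l
  have hl2 := le_ciSup h2 l
  have h := (le_abs_self _).trans (hab k l)
  rcases abs_cases (a k - a l) with ⟨h', -⟩ | ⟨h', -⟩ <;> linarith

theorem sum_units_int {M : Type*} [AddCommMonoid M] (f : ℤˣ → M) :
    ∑ s : ℤˣ, f s = f 1 + f (-1) := by
  exact (Finset.sum_pair (by decide : (1 : ℤˣ) ≠ -1))

theorem sum_fin_succ_pi {α M : Type*} [Fintype α] [DecidableEq α] [AddCommMonoid M] {m : ℕ}
    (f : (Fin (m + 1) → α) → M) :
    ∑ σ, f σ = ∑ s : α, ∑ σ : Fin m → α, f (Fin.cons s σ) := by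
  rw [← (Fin.consEquiv fun _ : Fin (m + 1) => α).sum_comp, Fintype.sum_prod_type]
  rfl

theorem abs_coe_units_int (s : ℤˣ) : |((s : ℤ) : ℝ)| = 1 := by
  rcases Int.units_eq_one_or s with h | h <;> simp [h]

theorem abs_sum_signs_mul_le {m : ℕ} (σ : Fin m → ℤˣ) {a : Fin m → ℝ} {A : ℝ}
    (ha : ∀ i, |a i| ≤ A) : |∑ i, ((σ i : ℤ) : ℝ) * a i| ≤ m * A := by
  refine (Finset.abs_sum_le_sum_abs _ _).trans ?_
  refine (Finset.sum_le_sum fun i _ => ?_).trans_eq (b := ∑ _i : Fin m, A) (by simp)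
  rw [abs_mul, abs_coe_units_int, one_mul]
  exact ha i

/-- Talagrand's contraction, one coordinate at a time. The arbitrary offset `u` makes the induction
work: it absorbs the first coordinate while the others are replaced, and then the others while the
first is. -/
theorem sum_signs_contraction {ι : Type*} [Nonempty ι] {A : ℝ} (m : ℕ) (u : ι → ℝ) (U : ℝ)
    (hu : ∀ k, |u k| ≤ U) (a b : ι → Fin m → ℝ) (ha : ∀ k i, |a k i| ≤ A)
    (hb : ∀ k i, |b k i| ≤ A) (hab : ∀ k l i, |b k i - b l i| ≤ |a k i - a l i|) :
    ∑ σ : Fin m → ℤˣ, ⨆ k, (u k + ∑ i, ((σ i : ℤ) : ℝ) * b k i) ≤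
      ∑ σ : Fin m → ℤˣ, ⨆ k, (u k + ∑ i, ((σ i : ℤ) : ℝ) * a k i) := by
  induction m generalizing u U with
  | zero => simp
  | succ m ih =>
    rw [sum_fin_succ_pi, sum_fin_succ_pi]
    have hsplit : ∀ (c : ι → Fin (m + 1) → ℝ) (s : ℤˣ) (σ : Fin m → ℤˣ) (k : ι),
        u k + ∑ i, (((Fin.cons s σ : Fin (m + 1) → ℤˣ) i : ℤ) : ℝ) * c k i =
          (u k + ((s : ℤ) : ℝ) * c k 0) + ∑ i, ((σ i : ℤ) : ℝ) * c k i.succ := by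
      intro c s σ k
      rw [Fin.sum_univ_succ]
      simp [add_assoc]
    simp only [hsplit]
    calc ∑ s : ℤˣ, ∑ σ : Fin m → ℤˣ,
          ⨆ k, (u k + ((s : ℤ) : ℝ) * b k 0 + ∑ i, ((σ i : ℤ) : ℝ) * b k i.succ)
        ≤ ∑ s : ℤˣ, ∑ σ : Fin m → ℤˣ,
          ⨆ k, (u k + ((s : ℤ) : ℝ) * b k 0 + ∑ i, ((σ i : ℤ) : ℝ) * a k i.succ) := by
          refine Finset.sum_le_sum fun s _ => ?_
          refine ih _ (U + A) (fun k => ?_) (fun k i => a k i.succ) (fun k i => b k i.succ)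
            (fun k i => ha _ _) (fun k i => hb _ _) fun k l i => hab _ _ _
          refine (abs_add_le _ _).trans (add_le_add (hu k) ?_)
          rw [abs_mul, abs_coe_units_int, one_mul]
          exact hb k 0
      _ ≤ _ := by
          rw [Finset.sum_comm, Finset.sum_comm (γ := ℤˣ)]
          refine Finset.sum_le_sum fun σ _ => ?_
          rw [sum_units_int, sum_units_int]
          have := ciSup_add_contraction (u := fun k => u k + ∑ i, ((σ i : ℤ) : ℝ) * a k i.succ)
            (a := fun k => a k 0) (b := fun k => b k 0) (U := U + m * A) (A := A)
            (fun k => (abs_add_le _ _).trans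
              (add_le_add (hu k) (abs_sum_signs_mul_le σ fun i => ha _ _)))
            (fun k => ha k 0) (fun k l => hab k l 0)
          convert this using 3 <;> (ext k; simp <;> ring)

/-- The average over all sign vectors of `sup_k (1/m) ∑ i, σ i * a k i`. -/
noncomputable def signAverage {ι : Type*} {m : ℕ} (a : ι → Fin m → ℝ) : ℝ :=
  (1 / 2 ^ m : ℝ) * ∑ σ : Fin m → ℤˣ, ⨆ k, (1 / m : ℝ) * ∑ i, ((σ i : ℤ) : ℝ) * a k i

theorem signAverage_contraction {ι : Type*} [Nonempty ι] {A : ℝ} {m : ℕ}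
    {a b : ι → Fin m → ℝ} (ha : ∀ k i, |a k i| ≤ A)
    (hb : ∀ k i, |b k i| ≤ A) (hab : ∀ k l i, |b k i - b l i| ≤ |a k i - a l i|) :
    signAverage b ≤ signAverage a := by
  have h := sum_signs_contraction m (fun _ : ι => (0 : ℝ)) 0 (by simp) a b ha hb hab
  simp only [zero_add] at h
  unfold signAverage
  have hm : (0 : ℝ) ≤ 1 / m := by positivity
  simp only [← Real.mul_iSup_of_nonneg hm, ← Finset.mul_sum]
  gcongr

/-- Averages of nonnegative combinations of members of `F` with coefficients bounded by `W`. -/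
theorem signAverage_linear_le {X ι : Type*} [Nonempty ι] {m D : ℕ} {F : Set (X → ℝ)}
    (hF0 : (0 : X → ℝ) ∈ F) (hFbdd : ∀ x, ∃ K, ∀ f ∈ F, |f x| ≤ K) {W : ℝ} (hW : 0 ≤ W)
    (φ : ι → Fin D → X → ℝ) (hφ : ∀ k j, φ k j ∈ F) (w : ι → Fin D → ℝ)
    (hw : ∀ k j, |w k j| ≤ W) (x : Fin m → X) :
    signAverage (fun k i => ∑ j, w k j * φ k j (x i)) ≤
      2 * D * W * empiricalRademacher F x := by
  choose K hK using hFbdd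
  set r : (Fin m → ℤˣ) → (X → ℝ) → ℝ :=
    fun σ f => (1 / m : ℝ) * ∑ i, ((σ i : ℤ) : ℝ) * f (x i) with hr
  set s : (Fin m → ℤˣ) → ℝ := fun σ => ⨆ f : F, r σ f with hs
  have hbdd : ∀ σ, BddAbove (Set.range fun f : F => r σ f) := by
    intro σ
    refine bddAbove_range_of_abs_le (K := (1 / m : ℝ) * (m * ∑ i, |K (x i)|)) fun f => ?_
    rw [hr, abs_mul, abs_of_nonneg (by positivity : (0 : ℝ) ≤ 1 / m)]
    refine mul_le_mul_of_nonneg_left (abs_sum_signs_mul_le σ fun i => ?_) (by positivity)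
    refine (hK (x i) f f.2).trans ((le_abs_self _).trans ?_)
    exact Finset.single_le_sum (f := fun i => |K (x i)|) (fun _ _ => abs_nonneg _)
      (Finset.mem_univ i)
  have hle : ∀ σ, ∀ f ∈ F, r σ f ≤ s σ := fun σ f hf => le_ciSup (hbdd σ) ⟨f, hf⟩
  have hs0 : ∀ σ, 0 ≤ s σ := fun σ => by simpa [hr] using hle σ 0 hF0
  have hneg : ∀ σ f, r (-σ) f = - r σ f := by
    intro σ f
    simp [hr]
  -- `F` need not be symmetric, so the absolute value is controlled by flipping the signs instead;
  -- `0 ∈ F` makes both suprema nonnegative. After averaging over `σ` this costs the factor 2.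
  have habs : ∀ σ, ∀ f ∈ F, |r σ f| ≤ s σ + s (-σ) := by
    intro σ f hf
    have h1 := hle σ f hf
    have h2 := hle (-σ) f hf
    rw [hneg] at h2
    rw [abs_le]
    constructor <;> linarith [hs0 σ, hs0 (-σ)]
  have hsup : ∀ σ : Fin m → ℤˣ,
      (⨆ k, (1 / m : ℝ) * ∑ i, ((σ i : ℤ) : ℝ) * ∑ j, w k j * φ k j (x i)) ≤
        D * W * (s σ + s (-σ)) := by
    intro σ
    refine ciSup_le fun k => ?_
    have : (1 / m : ℝ) * ∑ i, ((σ i : ℤ) : ℝ) * ∑ j, w k j * φ k j (x i)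
        = ∑ j, w k j * r σ (φ k j) := by
      simp only [hr, Finset.mul_sum]
      rw [Finset.sum_comm]
      refine Finset.sum_congr rfl fun j _ => Finset.sum_congr rfl fun i _ => ?_
      ring
    rw [this]
    calc ∑ j, w k j * r σ (φ k j) ≤ ∑ _j : Fin D, W * (s σ + s (-σ)) := by
          refine Finset.sum_le_sum fun j _ => (le_abs_self _).trans ?_
          rw [abs_mul]
          exact mul_le_mul (hw k j) (habs σ _ (hφ k j)) (abs_nonneg _) hW
      _ = _ := by simp; ring
  have hsneg : ∑ σ : Fin m → ℤˣ, s (-σ) = ∑ σ, s σ :=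
    Equiv.sum_comp (Equiv.neg (Fin m → ℤˣ)) s
  calc signAverage (fun k i => ∑ j, w k j * φ k j (x i))
      ≤ (1 / 2 ^ m : ℝ) * ∑ σ, D * W * (s σ + s (-σ)) := by
        unfold signAverage
        gcongr with σ
        exact hsup σ
    _ = 2 * D * W * ((1 / 2 ^ m : ℝ) * ∑ σ, s σ) := by
        rw [← Finset.mul_sum, Finset.sum_add_distrib, hsneg]
        ring
    _ = _ := rfl

/-! ### Symmetrization and uniform deviation for countable classes. -/

theorem abs_ciSup_le {ι : Type*} [Nonempty ι] {f : ι → ℝ} {K : ℝ} (h : ∀ k, |f k| ≤ K) :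
    |⨆ k, f k| ≤ K := by
  obtain ⟨k₀⟩ := ‹Nonempty ι›
  have : Nonempty ι := ⟨k₀⟩
  rw [abs_le]
  exact ⟨(abs_le.1 (h k₀)).1.trans (le_ciSup (bddAbove_range_of_abs_le h) k₀),
    ciSup_le fun k => (abs_le.1 (h k)).2⟩

theorem abs_ciSup_sub_le {ι : Type*} [Nonempty ι] {f g : ι → ℝ} {c : ℝ}
    (hf : BddAbove (Set.range f)) (hg : BddAbove (Set.range g)) (h : ∀ k, |f k - g k| ≤ c) :
    |(⨆ k, f k) - ⨆ k, g k| ≤ c := by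
  have h1 : (⨆ k, f k) ≤ (⨆ k, g k) + c :=
    ciSup_le fun k => by linarith [(abs_le.1 (h k)).2, le_ciSup hg k]
  have h2 : (⨆ k, g k) ≤ (⨆ k, f k) + c :=
    ciSup_le fun k => by linarith [(abs_le.1 (h k)).1, le_ciSup hf k]
  rw [abs_le]
  constructor <;> linarith

theorem MeasureTheory.MeasurePreserving.integral_comp_of_measurable {α β : Type*}
    [MeasurableSpace α] [MeasurableSpace β] {μ : Measure α} {ν : Measure β} {f : α → β}
    (hf : MeasurePreserving f μ ν) {g : β → ℝ} (hg : Measurable g) :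
    ∫ x, g (f x) ∂μ = ∫ y, g y ∂ν := by
  rw [← hf.map_eq, integral_map hf.measurable.aemeasurable hg.aestronglyMeasurable]

theorem abs_mean_signs_mul_le {m : ℕ} (hm : 0 < m) (σ : Fin m → ℤˣ) {a : Fin m → ℝ} {A : ℝ}
    (ha : ∀ i, |a i| ≤ A) : |(1 / m : ℝ) * ∑ i, ((σ i : ℤ) : ℝ) * a i| ≤ A := by
  have hm' : (0 : ℝ) < m := by exact_mod_cast hm
  rw [abs_mul, abs_of_pos (by positivity : (0 : ℝ) < 1 / m)]
  refine (mul_le_mul_of_nonneg_left (abs_sum_signs_mul_le σ ha) (by positivity)).trans_eq ?_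
  field_simp

theorem abs_mean_le {m : ℕ} (hm : 0 < m) {a : Fin m → ℝ} {A : ℝ}
    (ha : ∀ i, |a i| ≤ A) : |(1 / m : ℝ) * ∑ i, a i| ≤ A := by
  simpa using abs_mean_signs_mul_le hm (fun _ => 1) ha

theorem abs_deviation_update_sub_le {Z ι : Type*} [Nonempty ι] {l : ι → Z → ℝ} {M : ℝ} {m : ℕ}
    (hm : 0 < m) (hM : ∀ k z, l k z ∈ Set.Icc 0 M)
    (e : ι → ℝ) {C : ℝ} (he : ∀ k, |e k| ≤ C) (S : Fin m → Z) (i : Fin m) (z : Z) :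
    |(⨆ k, (e k - (1 / m : ℝ) * ∑ j, l k (Function.update S i z j))) -
      ⨆ k, (e k - (1 / m : ℝ) * ∑ j, l k (S j))| ≤ M / m := by
  have hm' : (0 : ℝ) < m := by exact_mod_cast hm
  have hb : ∀ T : Fin m → Z,
      BddAbove (Set.range fun k => e k - (1 / m : ℝ) * ∑ j, l k (T j)) := fun T =>
    bddAbove_range_of_abs_le (K := C + M) fun k => (abs_sub _ _).trans (add_le_add (he k)
      (abs_mean_le hm fun i => by rw [abs_of_nonneg (hM k (T i)).1]; exact (hM k (T i)).2))
  refine abs_ciSup_sub_le (hb _) (hb _) fun k => ?_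
  rw [sub_sub_sub_cancel_left, ← mul_sub, ← Finset.sum_sub_distrib,
    Finset.sum_eq_single i (fun j _ hj => by rw [Function.update_of_ne hj, sub_self]) (by simp),
    Function.update_self, abs_mul, abs_of_pos (by positivity : (0 : ℝ) < 1 / m), div_eq_mul_one_div M,
    mul_comm M]
  refine mul_le_mul_of_nonneg_left ?_ (by positivity)
  rw [abs_le]
  constructor <;> linarith [(hM k z).1, (hM k z).2, (hM k (S i)).1, (hM k (S i)).2]

section UniformDeviation

variable {Z ι : Type*} [MeasurableSpace Z] (μ : Measure Z) [IsProbabilityMeasure μ]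
  [Countable ι] {l : ι → Z → ℝ} {M : ℝ} {m : ℕ}

theorem measurable_signed_sup {Z' : Type*} [MeasurableSpace Z'] {g : ι → Z' → ℝ}
    (hg : ∀ k, Measurable (g k)) (σ : Fin m → ℤˣ) :
    Measurable fun S : Fin m → Z' => ⨆ k, (1 / m : ℝ) * ∑ i, ((σ i : ℤ) : ℝ) * g k (S i) := by
  refine Measurable.iSup fun k => ?_
  refine Measurable.const_mul ?_ _
  exact Finset.measurable_sum _ fun i _ =>
    ((hg k).comp (measurable_pi_apply i)).const_mul _

variable [Nonempty ι]

/-- The expectation of a loss is the mean of its average over an independent second sample, and a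
supremum of integrals is at most the integral of the supremum. -/
theorem integral_deviation_le_ghost (hm : 0 < m) (hl : ∀ k, Measurable (l k))
    (hM : ∀ k z, l k z ∈ Set.Icc 0 M) :
    ∫ S, (⨆ k, (∫ z, l k z ∂μ - (1 / m : ℝ) * ∑ i, l k (S i)))
        ∂(Measure.pi fun _ : Fin m => μ) ≤
      ∫ p : Fin m → Z × Z, (⨆ k, (1 / m : ℝ) * ∑ i, (l k (p i).2 - l k (p i).1))
        ∂(Measure.pi fun _ : Fin m => μ.prod μ) := by
  have hm' : (0 : ℝ) < m := by exact_mod_cast hm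
  set G : (Fin m → Z) × (Fin m → Z) → ℝ :=
    fun q => ⨆ k, (1 / m : ℝ) * ∑ i, (l k (q.2 i) - l k (q.1 i)) with hG
  have hterm : ∀ k (q : (Fin m → Z) × (Fin m → Z)),
      |(1 / m : ℝ) * ∑ i, (l k (q.2 i) - l k (q.1 i))| ≤ M := by
    refine fun k q => abs_mean_le hm fun i => ?_
    rw [abs_le]
    constructor <;> linarith [(hM k (q.2 i)).1, (hM k (q.2 i)).2, (hM k (q.1 i)).1,
      (hM k (q.1 i)).2]
  have htm : ∀ k, Measurable fun q : (Fin m → Z) × (Fin m → Z) =>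
      (1 / m : ℝ) * ∑ i, (l k (q.2 i) - l k (q.1 i)) := by
    intro k
    refine Measurable.const_mul (Finset.measurable_sum _ fun i _ => ?_) _
    exact ((hl k).comp ((measurable_pi_apply i).comp measurable_snd)).sub
      ((hl k).comp ((measurable_pi_apply i).comp measurable_fst))
  have hGm : Measurable G := Measurable.iSup htm
  have hGb : ∀ q, |G q| ≤ M := fun q => abs_ciSup_le fun k => hterm k q
  have hGi : Integrable G ((Measure.pi fun _ : Fin m => μ).prod (Measure.pi fun _ => μ)) :=
    integrable_of_measurable_of_abs_le hGm hGb
  have hli : ∀ k, Integrable (l k) μ := fun k =>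
    integrable_of_measurable_of_abs_le (hl k) (K := M) fun z => by
      rw [abs_of_nonneg (hM k z).1]; exact (hM k z).2
  have hpt : ∀ S : Fin m → Z, (⨆ k, (∫ z, l k z ∂μ - (1 / m : ℝ) * ∑ i, l k (S i))) ≤
      ∫ T, G (S, T) ∂(Measure.pi fun _ : Fin m => μ) := by
    refine fun S => ciSup_le fun k => ?_
    have hev : ∀ i : Fin m, MeasurePreserving (fun T : Fin m → Z => T i)
        (Measure.pi fun _ : Fin m => μ) μ := fun i =>
      measurePreserving_eval (fun _ : Fin m => μ) i
    have hlii : ∀ i : Fin m, Integrable (fun T : Fin m → Z => l k (T i))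
        (Measure.pi fun _ : Fin m => μ) := fun i => (hev i).integrable_comp_of_integrable (hli k)
    have heq : ∫ z, l k z ∂μ - (1 / m : ℝ) * ∑ i, l k (S i) =
        ∫ T : Fin m → Z, (1 / m : ℝ) * ∑ i, (l k (T i) - l k (S i))
          ∂(Measure.pi fun _ : Fin m => μ) := by
      have hsub : ∀ i : Fin m, Integrable (fun T : Fin m → Z => l k (T i) - l k (S i))
          (Measure.pi fun _ : Fin m => μ) := fun i => (hlii i).sub (integrable_const _)
      rw [integral_const_mul, integral_finsetSum _ fun i _ => hsub i]
      simp_rw [integral_sub (hlii _) (integrable_const _),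
        (hev _).integral_comp_of_measurable (hl k)]
      simp [mul_sub, hm'.ne']
    rw [heq]
    refine integral_mono
      (integrable_of_measurable_of_abs_le ((htm k).comp (measurable_const.prodMk measurable_id))
        fun T => hterm k (S, T))
      (integrable_of_measurable_of_abs_le (hGm.comp (measurable_const.prodMk measurable_id))
        fun T => hGb (S, T)) fun T => ?_
    exact le_ciSup (bddAbove_range_of_abs_le fun k => hterm k (S, T)) k
  have hdm : Measurable fun S : Fin m → Z =>
      ⨆ k, (∫ z, l k z ∂μ - (1 / m : ℝ) * ∑ i, l k (S i)) := by
    refine Measurable.iSup fun k => Measurable.const_sub (Measurable.const_mul ?_ _) _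
    exact Finset.measurable_sum _ fun i _ => (hl k).comp (measurable_pi_apply i)
  have hdb : ∀ S : Fin m → Z,
      |⨆ k, (∫ z, l k z ∂μ - (1 / m : ℝ) * ∑ i, l k (S i))| ≤ M + M := by
    refine fun S => abs_ciSup_le fun k => (abs_sub _ _).trans (add_le_add ?_ ?_)
    · have := norm_integral_le_of_norm_le_const (μ := μ) (f := l k) (C := M)
        (ae_of_all _ fun z => by
          rw [Real.norm_eq_abs, abs_of_nonneg (hM k z).1]; exact (hM k z).2)
      simpa using this
    · exact abs_mean_le hm fun i => by
        rw [abs_of_nonneg (hM k (S i)).1]; exact (hM k (S i)).2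
  calc _ ≤ ∫ S, ∫ T, G (S, T) ∂(Measure.pi fun _ : Fin m => μ)
          ∂(Measure.pi fun _ : Fin m => μ) :=
        integral_mono (integrable_of_measurable_of_abs_le hdm hdb) hGi.integral_prod_left hpt
    _ = ∫ q, G q ∂((Measure.pi fun _ : Fin m => μ).prod (Measure.pi fun _ => μ)) :=
        (integral_prod _ hGi).symm
    _ = _ := ((measurePreserving_arrowProdEquivProdArrow Z Z (Fin m) (fun _ => μ)
          fun _ => μ).integral_comp_of_measurable hGm).symm

/-- Exchanging the two points of pair `i` preserves the law and flips the sign of the `i`-th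
difference, so any `σ` may be inserted; the supremum then splits over the two samples. -/
theorem integral_ghost_le_sum (hm : 0 < m) (hl : ∀ k, Measurable (l k))
    (hM : ∀ k z, l k z ∈ Set.Icc 0 M) (σ : Fin m → ℤˣ) :
    ∫ p : Fin m → Z × Z, (⨆ k, (1 / m : ℝ) * ∑ i, (l k (p i).2 - l k (p i).1))
        ∂(Measure.pi fun _ : Fin m => μ.prod μ) ≤
      (∫ S, (⨆ k, (1 / m : ℝ) * ∑ i, ((σ i : ℤ) : ℝ) * l k (S i))
        ∂(Measure.pi fun _ : Fin m => μ)) +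
      ∫ S, (⨆ k, (1 / m : ℝ) * ∑ i, (((-σ) i : ℤ) : ℝ) * l k (S i))
        ∂(Measure.pi fun _ : Fin m => μ) := by
  have habs : ∀ k z, |l k z| ≤ M := fun k z => by
    rw [abs_of_nonneg (hM k z).1]; exact (hM k z).2
  have hdiff : ∀ k (p : Z × Z), |l k p.2 - l k p.1| ≤ M := by
    intro k p
    rw [abs_le]
    constructor <;> linarith [(hM k p.2).1, (hM k p.2).2, (hM k p.1).1, (hM k p.1).2]
  have hdm : ∀ k, Measurable fun p : Z × Z => l k p.2 - l k p.1 := fun k =>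
    ((hl k).comp measurable_snd).sub ((hl k).comp measurable_fst)
  set sw : ℤˣ → Z × Z → Z × Z := fun s => if s = 1 then id else Prod.swap with hsw
  have hswp : ∀ s, MeasurePreserving (sw s) (μ.prod μ) (μ.prod μ) := by
    intro s
    simp only [hsw]
    split_ifs
    · exact MeasurePreserving.id _
    · exact Measure.measurePreserving_swap
  have hswl : ∀ s k p, l k (sw s p).2 - l k (sw s p).1 =
      ((s : ℤ) : ℝ) * (l k p.2 - l k p.1) := by
    intro s k p
    rcases Int.units_eq_one_or s with rfl | rfl
    · simp [hsw]
    · simp [hsw, show (-1 : ℤˣ) ≠ 1 by decide]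
  have hG : Measurable fun p : Fin m → Z × Z =>
      ⨆ k, (1 / m : ℝ) * ∑ i, (l k (p i).2 - l k (p i).1) := by
    simpa using measurable_signed_sup (m := m) hdm fun _ => 1
  have hpi := measurePreserving_pi (fun _ : Fin m => μ.prod μ) (fun _ : Fin m => μ.prod μ)
    (f := fun i => sw (σ i)) fun i => hswp (σ i)
  rw [← hpi.integral_comp_of_measurable hG]
  simp only [hswl]
  have hfst := measurePreserving_pi (fun _ : Fin m => μ.prod μ) (fun _ : Fin m => μ)
    (f := fun i => Prod.fst) fun i => measurePreserving_fst
  have hsnd := measurePreserving_pi (fun _ : Fin m => μ.prod μ) (fun _ : Fin m => μ)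
    (f := fun i => Prod.snd) fun i => measurePreserving_snd
  have hms := measurable_signed_sup hl σ
  have hmn := measurable_signed_sup hl (-σ)
  have his : Integrable (fun p : Fin m → Z × Z =>
      ⨆ k, (1 / m : ℝ) * ∑ i, ((σ i : ℤ) : ℝ) * l k (p i).2)
      (Measure.pi fun _ : Fin m => μ.prod μ) :=
    integrable_of_measurable_of_abs_le (hms.comp hsnd.measurable)
      fun p => abs_ciSup_le fun k => abs_mean_signs_mul_le hm σ fun i => habs k _
  have hin : Integrable (fun p : Fin m → Z × Z =>
      ⨆ k, (1 / m : ℝ) * ∑ i, (((-σ) i : ℤ) : ℝ) * l k (p i).1)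
      (Measure.pi fun _ : Fin m => μ.prod μ) :=
    integrable_of_measurable_of_abs_le (hmn.comp hfst.measurable)
      fun p => abs_ciSup_le fun k => abs_mean_signs_mul_le hm (-σ) fun i => habs k _
  rw [← hsnd.integral_comp_of_measurable hms, ← hfst.integral_comp_of_measurable hmn,
    ← integral_add his hin]
  refine integral_mono
    (integrable_of_measurable_of_abs_le (measurable_signed_sup hdm σ)
      fun p => abs_ciSup_le fun k => abs_mean_signs_mul_le hm σ fun i => hdiff k _)
    (his.add hin)
    fun p => ciSup_le fun k => ?_
  have h1 := le_ciSup (bddAbove_range_of_abs_le fun k =>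
    abs_mean_signs_mul_le hm σ (a := fun i => l k (p i).2) fun i => habs k _) k
  have h2 := le_ciSup (bddAbove_range_of_abs_le fun k =>
    abs_mean_signs_mul_le hm (-σ) (a := fun i => l k (p i).1) fun i => habs k _) k
  refine le_trans (le_of_eq ?_) (add_le_add h1 h2)
  rw [← mul_add, ← Finset.sum_add_distrib]
  congr 1
  refine Finset.sum_congr rfl fun i _ => ?_
  simp
  ring

/-- Symmetrization. -/
theorem integral_deviation_le (hm : 0 < m) (hl : ∀ k, Measurable (l k))
    (hM : ∀ k z, l k z ∈ Set.Icc 0 M) :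
    ∫ S, (⨆ k, (∫ z, l k z ∂μ - (1 / m : ℝ) * ∑ i, l k (S i)))
        ∂(Measure.pi fun _ : Fin m => μ) ≤
      2 * ∫ S, signAverage (fun k i => l k (S i)) ∂(Measure.pi fun _ : Fin m => μ) := by
  have habs : ∀ k z, |l k z| ≤ M := fun k z => by
    rw [abs_of_nonneg (hM k z).1]; exact (hM k z).2
  refine (integral_deviation_le_ghost μ hm hl hM).trans ?_
  set I := ∫ p : Fin m → Z × Z, (⨆ k, (1 / m : ℝ) * ∑ i, (l k (p i).2 - l k (p i).1))
        ∂(Measure.pi fun _ : Fin m => μ.prod μ)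
  set R : (Fin m → ℤˣ) → ℝ := fun σ =>
    ∫ S, (⨆ k, (1 / m : ℝ) * ∑ i, ((σ i : ℤ) : ℝ) * l k (S i))
      ∂(Measure.pi fun _ : Fin m => μ) with hR
  have hsum : ∑ _σ : Fin m → ℤˣ, I ≤ ∑ σ, (R σ + R (-σ)) :=
    Finset.sum_le_sum fun σ _ => integral_ghost_le_sum μ hm hl hM σ
  have hneg : ∑ σ : Fin m → ℤˣ, R (-σ) = ∑ σ, R σ :=
    Equiv.sum_comp (Equiv.neg (Fin m → ℤˣ)) R
  have hcard : ((Fintype.card (Fin m → ℤˣ) : ℕ) : ℝ) = 2 ^ m := by simp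
  rw [Finset.sum_add_distrib, hneg, Finset.sum_const, Finset.card_univ, nsmul_eq_mul,
    hcard] at hsum
  have hint : ∫ S, signAverage (fun k i => l k (S i)) ∂(Measure.pi fun _ : Fin m => μ) =
      (1 / 2 ^ m : ℝ) * ∑ σ, R σ := by
    unfold signAverage
    rw [integral_const_mul, integral_finsetSum _ fun σ _ =>
      integrable_of_measurable_of_abs_le (measurable_signed_sup hl σ)
        fun S => abs_ciSup_le fun k => abs_mean_signs_mul_le hm σ fun i => habs k _]
  rw [hint]
  have h2 : (0 : ℝ) < 2 ^ m := by positivity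
  have := mul_le_mul_of_nonneg_left hsum (by positivity : (0 : ℝ) ≤ 1 / 2 ^ m)
  rw [← mul_assoc, one_div_mul_cancel h2.ne', one_mul] at this
  linarith

/-- Uniform deviation bound for a countable class of losses with values in `[0, M]`. -/
theorem uniform_deviation (hm : 0 < m) (hl : ∀ k, Measurable (l k))
    (hM : ∀ k z, l k z ∈ Set.Icc 0 M) {δ : ℝ} (hδ : 0 < δ) (hδ1 : δ < 1) :
    ENNReal.ofReal (1 - δ) ≤ (Measure.pi fun _ : Fin m => μ)
      {S | ∀ k, ∫ z, l k z ∂μ - (1 / m : ℝ) * ∑ i, l k (S i) ≤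
        2 * ∫ S, signAverage (fun k i => l k (S i)) ∂(Measure.pi fun _ : Fin m => μ) +
          M * √(Real.log (2 / δ) / (2 * m))} := by
  have hm' : (0 : ℝ) < m := by exact_mod_cast hm
  have hZ : Nonempty Z := μ.nonempty_of_neZero
  obtain ⟨k₀⟩ := ‹Nonempty ι›
  have hι : Nonempty ι := ⟨k₀⟩
  have hM0 : 0 ≤ M := (hM k₀ hZ.some).1.trans (hM k₀ hZ.some).2
  set Q : Measure (Fin m → Z) := Measure.pi fun _ : Fin m => μ with hQ
  -- McDiarmid's inequality needs a positive difference bound, so `M = 0` is treated apart.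
  rcases hM0.eq_or_lt with rfl | hMpos
  · have hl0 : ∀ k z, l k z = 0 := fun k z => le_antisymm (hM k z).2 (hM k z).1
    have : {S : Fin m → Z | ∀ k, ∫ z, l k z ∂μ - (1 / m : ℝ) * ∑ i, l k (S i) ≤
        2 * ∫ S, signAverage (fun k i => l k (S i)) ∂Q + 0 * √(Real.log (2 / δ) / (2 * m))} =
        Set.univ := by
      simp [hl0, signAverage]
    rw [this, measure_univ]
    exact ENNReal.ofReal_le_one.2 (by linarith)
  have he : ∀ k, |∫ z, l k z ∂μ| ≤ M := by
    intro k
    have := norm_integral_le_of_norm_le_const (μ := μ) (f := l k) (C := M)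
        (ae_of_all _ fun z => by
          rw [Real.norm_eq_abs, abs_of_nonneg (hM k z).1]; exact (hM k z).2)
    simpa using this
  set f : (Fin m → Z) → ℝ := fun S => ⨆ k, (∫ z, l k z ∂μ - (1 / m : ℝ) * ∑ i, l k (S i)) with hf
  have hfm : Measurable f := by
    refine Measurable.iSup fun k => Measurable.const_sub (Measurable.const_mul ?_ _) _
    exact Finset.measurable_sum _ fun i _ => (hl k).comp (measurable_pi_apply i)
  have htb : ∀ (S : Fin m → Z) k,
      |∫ z, l k z ∂μ - (1 / m : ℝ) * ∑ i, l k (S i)| ≤ M + M := fun S k =>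
    (abs_sub _ _).trans (add_le_add (he k) (abs_mean_le hm fun i => by
        rw [abs_of_nonneg (hM k (S i)).1]; exact (hM k (S i)).2))
  have hfb : ∀ S, |f S| ≤ M + M := fun S => abs_ciSup_le (htb S)
  have hlog : 0 ≤ Real.log (2 / δ) := Real.log_nonneg (by rw [le_div_iff₀ hδ]; linarith)
  set ε := M * √(Real.log (2 / δ) / (2 * m)) with hε
  have htail := measureReal_le_exp_of_bounded_differences μ (c := M / m) (by positivity) hm hfm
    hfb (abs_deviation_update_sub_le hm hM _ he) (ε := ε) (by positivity)
  -- The left side is exactly `δ / 2`: the deviation is one-sided, so half of `δ` is to spare.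
  have hexp : Real.exp (-(2 * ε ^ 2 / (m * (M / m) ^ 2))) ≤ δ := by
    have : 2 * ε ^ 2 / (m * (M / m) ^ 2) = Real.log (2 / δ) := by
      rw [hε, mul_pow, Real.sq_sqrt (by positivity)]
      field_simp
    rw [this, Real.exp_neg, Real.exp_log (by positivity), inv_div]
    linarith
  have hbad : MeasurableSet {S | ∫ S, f S ∂Q + ε ≤ f S} := measurableSet_le measurable_const hfm
  have hgood : 1 - δ ≤ Q.real {S | ∫ S, f S ∂Q + ε ≤ f S}ᶜ := by
    rw [probReal_compl_eq_one_sub hbad]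
    linarith [htail.trans hexp]
  refine (ENNReal.ofReal_le_ofReal hgood).trans ?_
  rw [Measure.real, ENNReal.ofReal_toReal (measure_ne_top _ _)]
  refine measure_mono fun S hS k => ?_
  have h1 : f S < ∫ S, f S ∂Q + ε := not_le.1 hS
  have h2 := le_ciSup (bddAbove_range_of_abs_le (htb S)) k
  exact h2.trans (h1.le.trans (by gcongr; exact integral_deviation_le μ hm hl hM))

end UniformDeviation

/-! ### Diversity and the bound on hypotheses. -/

theorem sum_offDiag_sub_sq {D : ℕ} (a : Fin D → ℝ) :
    (1 / 2 : ℝ) * ∑ p ∈ (Finset.univ : Finset (Fin D)).offDiag, (a p.1 - a p.2) ^ 2 =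
      D * ∑ i, a i ^ 2 - (∑ i, a i) ^ 2 := by
  have h : ∑ p ∈ (Finset.univ : Finset (Fin D)).offDiag, (a p.1 - a p.2) ^ 2 =
      ∑ p : Fin D × Fin D, (a p.1 - a p.2) ^ 2 := by
    refine Finset.sum_subset (Finset.subset_univ _) fun p _ hp => ?_
    have : p.1 = p.2 := by simpa using hp
    rw [this]
    ring
  rw [h, Fintype.sum_prod_type]
  simp only [sub_sq, Finset.sum_add_distrib, Finset.sum_sub_distrib, Finset.sum_const,
    Finset.card_univ, Fintype.card_fin, nsmul_eq_mul, ← Finset.mul_sum, ← Finset.sum_mul]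
  ring

theorem IsFeatureMap.sum_le {X : Type*} {D : ℕ} {F : Set (X → ℝ)} {A ϑ : ℝ}
    {Φ : Fin D → X → ℝ} (hΦ : IsFeatureMap F A Φ) (hd : IsDiverse ϑ Φ) (x : X) :
    ∑ i, Φ i x ≤ √(D * A ^ 2 - ϑ ^ 2) := by
  apply Real.le_sqrt_of_sq_le
  have h1 := hd x
  rw [sum_offDiag_sub_sq fun i => Φ i x] at h1
  have h2 : ∑ i, Φ i x ^ 2 ≤ A ^ 2 := by
    have h3 := pow_le_pow_left₀ (norm_nonneg _) (hΦ.norm_le x) 2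
    rw [EuclideanSpace.norm_sq_eq] at h3
    simpa using h3
  have h4 := mul_le_mul_of_nonneg_left h2 (Nat.cast_nonneg (α := ℝ) D)
  linarith

theorem IsFeatureMap.abs_weighted_sum_le {X : Type*} {D : ℕ} {F : Set (X → ℝ)} {A ϑ W : ℝ}
    {Φ : Fin D → X → ℝ} (hΦ : IsFeatureMap F A Φ) (hd : IsDiverse ϑ Φ) {w : Fin D → ℝ}
    (hw : ‖w‖ ≤ W) (x : X) : |∑ i, w i * Φ i x| ≤ W * √(D * A ^ 2 - ϑ ^ 2) := by
  have hW : 0 ≤ W := (norm_nonneg w).trans hw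
  calc |∑ i, w i * Φ i x| ≤ ∑ i, |w i * Φ i x| := Finset.abs_sum_le_sum_abs _ _
    _ ≤ ∑ i, W * Φ i x := by
        refine Finset.sum_le_sum fun i _ => ?_
        rw [abs_mul, abs_of_nonneg (hΦ.nonneg i x)]
        exact mul_le_mul_of_nonneg_right ((norm_le_pi_norm w i).trans hw) (hΦ.nonneg i x)
    _ = W * ∑ i, Φ i x := (Finset.mul_sum _ _ _).symm
    _ ≤ _ := mul_le_mul_of_nonneg_left (hΦ.sum_le hd x) hW

/-! ### The generalization bound: countable classes, then the random class. -/

theorem tendsto_generalizationGap_energyL1 {X : Type*} [MeasurableSpace X] {m : ℕ}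
    {μ : Measure (X × ℝ)} [IsProbabilityMeasure μ] {B C : ℝ} (hB : ∀ᵐ z ∂μ, |z.2| ≤ B)
    {h : ℕ → X → ℝ} {h₀ : X → ℝ} (hm : ∀ n, Measurable (h n)) (hC : ∀ n x, |h n x| ≤ C)
    (hlim : ∀ x, Tendsto (fun n => h n x) atTop (𝓝 (h₀ x))) (S : Fin m → X × ℝ) :
    Tendsto (fun n => generalizationGap energyL1 μ S (h n)) atTop
      (𝓝 (generalizationGap energyL1 μ S h₀)) := by
  have hE : ∀ x y, Tendsto (fun n => energyL1 (h n) x y) atTop (𝓝 (energyL1 h₀ x y)) :=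
    fun x y => ((hlim x).sub_const y).abs
  refine Tendsto.sub ?_ (tendsto_const_nhds.mul (tendsto_finsetSum _ fun i _ => hE _ _))
  refine tendsto_integral_of_dominated_convergence (fun _ => C + B) (fun n => ?_)
    (integrable_const _) (fun n => ?_) (ae_of_all _ fun z => hE _ _)
  · exact (((hm n).comp measurable_fst).sub measurable_snd).abs.aestronglyMeasurable
  · filter_upwards [hB] with z hz
    rw [energyL1, Real.norm_eq_abs, abs_abs]
    exact (abs_sub _ _).trans (add_le_add (hC n _) hz)

theorem uniform_gap_countable {X ι : Type*} [MeasurableSpace X] [Countable ι] [Nonempty ι]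
    (μ : Measure (X × ℝ)) [IsProbabilityMeasure μ] {m D : ℕ} (hm : 0 < m) {A B W ϑ δ : ℝ}
    (hW : 0 ≤ W) (hδ : 0 < δ) (hδ1 : δ < 1) (hB : ∀ᵐ z ∂μ, |z.2| ≤ B)
    {F : Set (X → ℝ)} (hF0 : (0 : X → ℝ) ∈ F) (hFbdd : ∀ x, ∃ K, ∀ f ∈ F, |f x| ≤ K)
    (hFint : Integrable
      (fun S : Fin m → X × ℝ => empiricalRademacher F (fun i => (S i).1))
      (Measure.pi fun _ => μ))
    {φ : ι → Fin D → X → ℝ} (hφm : ∀ k i, Measurable (φ k i))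
    (hφ : ∀ k, IsFeatureMap F A (φ k)) (hd : ∀ k, IsDiverse ϑ (φ k))
    {w : ι → Fin D → ℝ} (hw : ∀ k, ‖w k‖ ≤ W) :
    ENNReal.ofReal (1 - δ) ≤ (Measure.pi fun _ : Fin m => μ)
      {S | ∀ k, generalizationGap energyL1 μ S (fun x => ∑ i, w k i * φ k i x) ≤
          4 * D * W * rademacher μ m F +
            (W * √(D * A ^ 2 - ϑ ^ 2) + B) * √(Real.log (2 / δ) / (2 * m))} := by
  obtain ⟨z₀, hz₀⟩ := hB.exists
  have hB0 : 0 ≤ B := (abs_nonneg _).trans hz₀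
  set h : ι → X → ℝ := fun k x => ∑ i, w k i * φ k i x with hh
  set V := W * √(D * A ^ 2 - ϑ ^ 2) with hV
  have hhV : ∀ k x, |h k x| ≤ V := fun k x => (hφ k).abs_weighted_sum_le (hd k) (hw k) x
  have hhm : ∀ k, Measurable (h k) := fun k =>
    Finset.measurable_sum _ fun i _ => (hφm k i).const_mul _
  -- Labels are bounded only almost everywhere, while `uniform_deviation` wants losses bounded
  -- everywhere. Clipping to `[-B, B]` achieves this and changes nothing almost surely.
  set clip : ℝ → ℝ := fun y => max (-B) (min B y) with hclip
  have hclip_le : ∀ y, |clip y| ≤ B := fun y =>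
    abs_le.2 ⟨le_max_left _ _, max_le (by linarith) (min_le_left _ _)⟩
  have hclip_eq : ∀ y, |y| ≤ B → clip y = y := fun y hy => by
    rw [hclip]
    simp only
    rw [min_eq_right (abs_le.1 hy).2, max_eq_right (abs_le.1 hy).1]
  set l : ι → X × ℝ → ℝ := fun k z => |h k z.1 - clip z.2| with hl
  have hlm : ∀ k, Measurable (l k) := fun k =>
    (((hhm k).comp measurable_fst).sub
      (measurable_const.max (measurable_const.min measurable_snd))).abs
  have hlM : ∀ k z, l k z ∈ Set.Icc 0 (V + B) := fun k z =>
    ⟨abs_nonneg _, (abs_sub _ _).trans (add_le_add (hhV k _) (hclip_le _))⟩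
  have hmain := uniform_deviation μ hm hlm hlM hδ hδ1
  have hpt : ∀ S : Fin m → X × ℝ, signAverage (fun k i => l k (S i)) ≤
      2 * D * W * empiricalRademacher F (fun i => (S i).1) := by
    intro S
    refine (signAverage_contraction (A := V + B) (a := fun k i => h k (S i).1)
      (fun k i => (hhV k _).trans (by linarith)) (fun k i => ?_) fun k k' i => ?_).trans
      (signAverage_linear_le hF0 hFbdd hW φ (fun k j => (hφ k).mem j) w
        (fun k j => (norm_le_pi_norm (w k) j).trans (hw k)) fun i => (S i).1)
    · rw [abs_of_nonneg (hlM k (S i)).1]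
      exact (hlM k (S i)).2
    -- The clipped label depends on `i` alone, so it cancels between two hypotheses.
    · refine (abs_abs_sub_abs_le _ _).trans_eq ?_
      rw [sub_sub_sub_cancel_right]
  have hint : ∫ S, signAverage (fun k i => l k (S i)) ∂(Measure.pi fun _ : Fin m => μ) ≤
      2 * D * W * rademacher μ m F := by
    rw [rademacher, ← integral_const_mul]
    refine integral_mono ?_ (hFint.const_mul _) hpt
    unfold signAverage
    refine (integrable_finsetSum _ fun σ _ => ?_).const_mul _
    exact integrable_of_measurable_of_abs_le (measurable_signed_sup hlm σ) fun S =>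
      abs_ciSup_le fun k => abs_mean_signs_mul_le hm σ (A := V + B) fun i => by
        rw [abs_of_nonneg (hlM k (S i)).1]
        exact (hlM k (S i)).2
  refine hmain.trans (measure_mono_ae ?_)
  have hae : ∀ᵐ S ∂(Measure.pi fun _ : Fin m => μ), ∀ i, |(S i).2| ≤ B :=
    ae_all_iff.2 fun i =>
      (measurePreserving_eval (fun _ : Fin m => μ) i).quasiMeasurePreserving.ae hB
  filter_upwards [hae] with S hS hS' k
  have hgap : generalizationGap energyL1 μ S (h k) =
      ∫ z, l k z ∂μ - (1 / m : ℝ) * ∑ i, l k (S i) := by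
    unfold generalizationGap
    congr 1
    · refine integral_congr_ae ?_
      filter_upwards [hB] with z hz
      simp only [hl, energyL1, hclip_eq _ hz]
    · simp only [hl, energyL1, hclip_eq _ (hS _)]
  change generalizationGap energyL1 μ S (h k) ≤ _
  rw [hgap]
  refine (hS' k).trans ?_
  linarith

theorem theorem2 {X Ω : Type*} [MeasurableSpace X] [MeasurableSpace Ω]
    (P : Measure Ω) [IsProbabilityMeasure P]
    (μ : Measure (X × ℝ)) [IsProbabilityMeasure μ]
    (m D : ℕ) (hm : 0 < m) (A B W ϑ τ δ : ℝ) (hδ : 0 < δ) (hδ1 : δ < 1)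
    (Y : Set ℝ) (hY : ∀ y ∈ Y, |y| ≤ B) (hμY : ∀ᵐ z ∂μ, z.2 ∈ Y)
    (F : Set (X → ℝ)) (hF0 : (0 : X → ℝ) ∈ F)
    (hFbdd : ∀ x, ∃ K, ∀ f ∈ F, |f x| ≤ K)
    (hFint : Integrable
      (fun S : Fin m → X × ℝ => empiricalRademacher F (fun i => (S i).1))
      (Measure.pi fun _ => μ))
    (𝒢 : Ω → Set (Fin D → X → ℝ))
    (h𝒢 : IsMeasurableFeatureClass 𝒢)
    (hfeat : ∀ ω, ∀ Φ ∈ 𝒢 ω, IsFeatureMap F A Φ)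
    (hdiv : HoldsWithProbAtLeast P τ fun ω => ∀ Φ ∈ 𝒢 ω, IsDiverse ϑ Φ) :
    HoldsWithProbAtLeast (P.prod (Measure.pi fun _ : Fin m => μ)) ((1 - δ) * τ)
      fun q : Ω × (Fin m → X × ℝ) => ∀ h ∈ hypothesisClass W (𝒢 q.1),
        generalizationGap energyL1 μ q.2 h ≤
          4 * D * W * rademacher μ m F +
            (W * √(D * A ^ 2 - ϑ ^ 2) + B) * √(Real.log (2 / δ) / (2 * m)) := by
  obtain ⟨E₀, hE₀m, hE₀, hE₀P⟩ := hdiv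
  obtain ⟨g, hgm, hg⟩ := h𝒢
  have hprob : ENNReal.ofReal ((1 - δ) * τ) ≤ ENNReal.ofReal (1 - δ) * P E₀ := by
    rw [ENNReal.ofReal_mul (by linarith)]
    gcongr
  -- For negative `W` the hypothesis class is empty.
  rcases lt_or_ge W 0 with hW | hW
  · refine ⟨Set.univ, MeasurableSet.univ, ?_, ?_⟩
    · rintro q - h ⟨Φ, -, w, hw, -⟩
      exact absurd ((norm_nonneg w).trans hw) (not_le.2 hW)
    · rw [measure_univ]
      exact hprob.trans (mul_le_one' (ENNReal.ofReal_le_one.2 (by linarith)) prob_le_one)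
  have hB : ∀ᵐ z ∂μ, |z.2| ≤ B := hμY.mono fun z hz => hY _ hz
  have : Nonempty {w : Fin D → ℝ // ‖w‖ ≤ W} := ⟨⟨0, by simpa using hW⟩⟩
  set v : ℕ → {w : Fin D → ℝ // ‖w‖ ≤ W} := TopologicalSpace.denseSeq _ with hv
  set b := 4 * D * W * rademacher μ m F +
    (W * √(D * A ^ 2 - ϑ ^ 2) + B) * √(Real.log (2 / δ) / (2 * m)) with hb
  set H : ℕ × ℕ → Ω → X → ℝ := fun n ω x => ∑ i, (v n.2).1 i * g n.1 ω i x with hH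
  have hHm : ∀ n, Measurable fun p : Ω × X => H n p.1 p.2 := fun n =>
    Finset.measurable_sum _ fun i _ => (hgm n.1 i).const_mul _
  -- Only countably many hypotheses are tested, so this event is measurable.
  set E : Set (Ω × (Fin m → X × ℝ)) :=
    {q | q.1 ∈ E₀ ∧ ∀ n, generalizationGap energyL1 μ q.2 (H n q.1) ≤ b} with hE
  have hgapm : ∀ n, Measurable fun q : Ω × (Fin m → X × ℝ) =>
      generalizationGap energyL1 μ q.2 (H n q.1) := by
    intro n
    have h1 : Measurable fun p : Ω × (X × ℝ) => energyL1 (H n p.1) p.2.1 p.2.2 :=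
      (((hHm n).comp (measurable_fst.prodMk (measurable_fst.comp measurable_snd))).sub
        (measurable_snd.comp measurable_snd)).abs
    refine Measurable.sub ?_ (Measurable.const_mul (Finset.measurable_sum _ fun i _ => ?_) _)
    · exact (h1.stronglyMeasurable.integral_prod_right').measurable.comp measurable_fst
    · exact h1.comp (measurable_fst.prodMk ((measurable_pi_apply i).comp measurable_snd))
  have hEm : MeasurableSet E := by
    rw [hE, Set.ofPred_and, Set.ofPred_forall]
    exact (measurable_fst hE₀m).inter
      (MeasurableSet.iInter fun n => measurableSet_le (hgapm n) measurable_const)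
  refine ⟨E, hEm, ?_, hprob.trans ?_⟩
  -- An arbitrary hypothesis is a pointwise limit of tested ones, uniformly bounded by diversity, so
  -- dominated convergence carries the bound over.
  · rintro ⟨ω, S⟩ ⟨hω, hS⟩ h ⟨Φ, hΦ, w, hw, rfl⟩
    obtain ⟨k, hk⟩ := (hg ω).2 Φ hΦ
    obtain ⟨u, hu, hulim⟩ := mem_closure_iff_seq_limit.1
      (TopologicalSpace.denseRange_denseSeq {w : Fin D → ℝ // ‖w‖ ≤ W} ⟨w, hw⟩)
    choose j hj using hu
    have hulim' : ∀ i, Tendsto (fun n => (v (j n)).1 i) atTop (𝓝 (w i)) := by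
      have := (continuous_subtype_val.tendsto _).comp hulim
      rw [tendsto_pi_nhds] at this
      intro i
      simpa [Function.comp_def, ← hj] using this i
    refine le_of_tendsto (tendsto_generalizationGap_energyL1 hB
      (h := fun n => H (k n, j n) ω) (C := W * √(D * A ^ 2 - ϑ ^ 2)) (fun n => ?_)
      (fun n x => ?_) (fun x => ?_) S) (Eventually.of_forall fun n => hS (k n, j n))
    · exact (hHm _).comp measurable_prodMk_left
    · have hmem := (hg ω).1 (k n)
      exact (hfeat ω _ hmem).abs_weighted_sum_le (hE₀ ω hω _ hmem) (v (j n)).2 x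
    · exact tendsto_finsetSum _ fun i _ => (hulim' i).mul (hk i x)
  -- Every section of `E` over `E₀` has probability at least `1 - δ`; integrating over `E₀` gives
  -- the product.
  · rw [Measure.prod_apply hEm, ← setLIntegral_const]
    refine (setLIntegral_mono' hE₀m fun ω hω => ?_).trans (setLIntegral_le_lintegral _ _)
    refine (uniform_gap_countable (ι := ℕ × ℕ) μ hm hW hδ hδ1 hB hF0 hFbdd hFint
      (φ := fun n => g n.1 ω) (w := fun n => (v n.2).1)
      (fun n i => (hgm n.1 i).comp measurable_prodMk_left)
      (fun n => hfeat ω _ ((hg ω).1 n.1)) (fun n => hE₀ ω hω _ ((hg ω).1 n.1))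
      fun n => (v n.2).2).trans (measure_mono fun S hS => ⟨hω, hS⟩)
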